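/- Let $\mathcal L$ be a first-order language and let $\mathfrak C$ be a monster model of a complete $\mathcal L$-theory with infinite models, i.e. $\mathfrak C$ is an infinite $\mathcal L$-structure which is $\kappa$-saturated and strongly $\kappa$-homogeneous for some cardinal $\kappa$. Let $M\preceq\mathfrak C$ be small, i.e. $|M|<\kappa$, and let $\bar m$ be an enumeration of $M$. Let $\mathfrak C'\succeq\mathfrak C$ be a bigger monster model in which $\mathfrak C$ is small, i.e. $\mathfrak C'$ is $\kappa'$-saturated and strongly $\kappa'$-homogeneous for some $\kappa'>|\mathfrak C|$. Let $\bar x$ and $\bar y$ be tuples of variables corresponding to $\bar m$. Let $S_{\bar m}(\mathfrak C)$ be the set of complete types over $\mathfrak C$ in the variables $\bar y$ which contain $\mathrm{tp}(\bar m/\emptyset)$, and let $S^{\mathrm{inv}}_{\bar m}(\mathfrak C,M)$ be the set of those $p\in S_{\bar m}(\mathfrak C)$ which are $M$-invariant: for every $\mathcal L$-formula $\varphi(\bar z;\bar y)$ and all tuples $\bar a,\bar b$ from $\mathfrak C$ with $\mathrm{tp}(\bar a/M)=\mathrm{tp}(\bar b/M)$, one has $\varphi(\bar a;\bar y)\in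 p$ if and only if $\varphi(\bar b;\bar y)\in p$. For $\bar b\in\mathfrak C^{\bar x}$ let $h_{\bar b}\colon S_{\bar m}(\mathfrak C)\to S_{\bar x}(M)$ be the (well-defined) map $\mathrm{tp}(\sigma(\bar m)/\mathfrak C)\mapsto\mathrm{tp}(\sigma^{-1}(\bar b)/M)$, $\sigma\in\mathrm{Aut}(\mathfrak C')$. For $p,q\in S^{\mathrm{inv}}_{\bar m}(\mathfrak C,M)$, the product $p*q$ is defined as follows: for every $\mathcal L$-formula $\varphi(\bar x;\bar y)$ and every $\bar b\in\mathfrak C^{\bar x}$, $$\varphi(\bar b;\bar y)\in p*q\iff\varphi(\bar x;\bar y)\in p_{\bar y}\otimes (h_{\bar b}(q))_{\bar x},$$ where $\otimes$ is the Morley product, i.e. the right-hand side means that $\varphi(\bar a;\bar y)\in p$ for some (equivalently, every) $\bar a\in\mathfrak C^{\bar x}$ realizing $h_{\bar b}(q)$. Then: 1. $S^{\mathrm{inv}}_{\bar m}(\mathfrak C,M)$ is closed under $*$: if $p,q\in S^{\mathrm{inv}}_{\bar m}(\mathfrak C,M)$, then $p*q\in S^{\mathrm{inv}}_{\bar m}(\mathfrak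 C,M)$. 2. For all $p,q,r\in S^{\mathrm{inv}}_{\bar m}(\mathfrak C,M)$ we have $(p*q)*r=p*(q*r)$. (No NIP and no definability assumption is made.) -/

import Mathlib

open FirstOrder Cardinal

universe u v w x y z

namespace StarProduct

section Basic

variable {L : FirstOrder.Language.{u, v}}

/-- For a set `A` of parameters, an `L_Y(A)`-formula, i.e. a formula with free variables among `Y`
and parameters from `A`, is represented by an `L`-formula with free variables in `A ⊕ Y`, where the
variables from the left summand stand for the parameters themselves. -/
abbrev ParamFormula (L : FirstOrder.Language.{u, v}) (A : Type w) (Y : Type x) : Type (max u v w x) :=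
  L.Formula (A ⊕ Y)

/-- `C` is `κ`-saturated: every set of formulas in one variable over a set `A ⊆ C` of
cardinality less than `κ` which is finitely satisfiable in `C` is realized in `C`. -/
def IsSaturated (L : FirstOrder.Language.{u, v}) (C : Type w) [L.Structure C] (κ : Cardinal.{w}) : Prop :=
  ∀ A : Set C, #A < κ → ∀ Γ : Set (ParamFormula L A Unit),
    (∀ s : Finset (ParamFormula L A Unit), (s : Set _) ⊆ Γ →
      ∃ c : C, ∀ φ ∈ s, φ.Realize (Sum.elim (fun a : A => (a : C)) fun _ => c)) →
    ∃ c : C, ∀ φ ∈ Γ, φ.Realize (Sum.elim (fun a : A => (a : C)) fun _ => c)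

/-- `C` is strongly `κ`-homogeneous: every partial elementary map from a subset of `C` of
cardinality less than `κ` to `C` extends to an automorphism of `C`. -/
def IsStronglyHomogeneous (L : FirstOrder.Language.{u, v}) (C : Type w) [L.Structure C]
    (κ : Cardinal.{w}) : Prop :=
  ∀ A : Set C, #A < κ → ∀ f : A → C,
    (∀ φ : L.Formula A, φ.Realize (fun a : A => (a : C)) ↔ φ.Realize f) →
    ∃ σ : C ≃[L] C, ∀ a : A, σ a = f a

/-- A monster model, with degree of saturation and homogeneity `κ`. -/
structure IsMonster (L : FirstOrder.Language.{u, v}) (C : Type w) [L.Structure C]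
    (κ : Cardinal.{w}) : Prop where
  saturated : IsSaturated L C κ
  homogeneous : IsStronglyHomogeneous L C κ

/-- The complete type `tp(a/A)` of a tuple `a` in a structure `N`, where the parameters from `A`
are interpreted in `N` through `e` (in practice, an inclusion `A ⊆ N`). -/
def tp {A : Type w} {N : Type x} {Y : Type y} [L.Structure N] (e : A → N) (a : Y → N) :
    Set (ParamFormula L A Y) :=
  {φ | φ.Realize (Sum.elim e a)}

/-- The formula `φ(b; y)` over `C`, for an `L`-formula `φ(x; y)` and a tuple `b` from `C`. -/
def inst {C : Type w} {X : Type x} {Y : Type y} (φ : L.Formula (X ⊕ Y)) (b : X → C) :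
    ParamFormula L C Y :=
  φ.relabel (Sum.map b id)

end Basic

section Types

variable {L : FirstOrder.Language.{u, v}} {C : Type w} [L.Structure C]

/-- `S_Y(C)`: complete types over `C` in the variables `Y`. -/
structure IsCompleteType {Y : Type x} (p : Set (ParamFormula L C Y)) : Prop where
  finitelySatisfiable : ∀ s : Finset (ParamFormula L C Y), (s : Set _) ⊆ p →
    ∃ v : Y → C, ∀ φ ∈ s, φ.Realize (Sum.elim id v)
  complete : ∀ φ : ParamFormula L C Y, φ ∈ p ∨ φ.not ∈ p

/-- `p` is invariant over `M`: for every `L`-formula `φ(z; y)` and tuples `a`, `b` from `C` with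
`tp(a/M) = tp(b/M)`, we have `φ(a; y) ∈ p` if and only if `φ(b; y) ∈ p`. -/
def IsInvariant (M : L.ElementarySubstructure C) {Y : Type x}
    (p : Set (ParamFormula L C Y)) : Prop :=
  ∀ (n : ℕ) (φ : L.Formula (Fin n ⊕ Y)) (a b : Fin n → C),
    tp (L := L) (fun m : M => (m : C)) a = tp (L := L) (fun m : M => (m : C)) b →
    (inst φ a ∈ p ↔ inst φ b ∈ p)

variable {M : L.ElementarySubstructure C} {I : Type x}

/-- The tuple of elements of `C` given by an enumeration of `M`. -/
def tuple (m : I ≃ M) : I → C := fun i => (m i : C)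

/-- `S_m(C)`: complete types over `C` which contain `tp(m/∅)`. -/
def typesAt (m : I ≃ M) : Set (Set (ParamFormula L C I)) :=
  {p | IsCompleteType p ∧
    ∀ φ : L.Formula I, φ.Realize (tuple m) → φ.relabel (Sum.inr : I → C ⊕ I) ∈ p}

/-- `S_m^inv(C, M)`: complete types over `C` which contain `tp(m/∅)` and are invariant
over `M`. -/
def invTypesAt (m : I ≃ M) : Set (Set (ParamFormula L C I)) :=
  {p | p ∈ typesAt m ∧ IsInvariant M p}

variable {C' : Type y} [L.Structure C']

/-- The map `h_b : S_m(C) → S_x(M)`, `tp(σ(m)/C) ↦ tp(σ⁻¹(b)/M)` for `σ ∈ Aut(C')`, where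
`ι : C → C'` is the inclusion. As the value does not depend on the choice of `σ`, it is written as
the union over all such `σ`. -/
def h (ι : C ↪ₑ[L] C') (m : I ≃ M) {X : Type z} (b : X → C) (q : Set (ParamFormula L C I)) :
    Set (ParamFormula L M X) :=
  {θ | ∃ σ : C' ≃[L] C', q = tp ι (fun i => σ (ι (tuple m i))) ∧
    θ ∈ tp (fun a : M => ι (a : C)) (fun j => σ.symm (ι (b j)))}

/-- The Morley product `p_y ⊗ q_x` of an `M`-invariant type `p` over `C` with a type `q` over `M`:
an `L(M)`-formula `φ(x; y)` belongs to it if and only if `φ(a; y) ∈ p`, where `a` is a tuple in `C`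
realizing `q`. -/
def morley {X : Type z} (p : Set (ParamFormula L C I)) (q : Set (ParamFormula L M X)) :
    Set (ParamFormula L M (X ⊕ I)) :=
  {φ | ∃ a : X → C, tp (L := L) (fun c : M => (c : C)) a = q ∧
    φ.relabel (Sum.elim (fun c : M => Sum.inl (c : C)) (Sum.map a id)) ∈ p}

/-- The product `p * q`: for an `L`-formula `φ(x; y)` and a tuple `b` from `C`, where `x` and `y`
correspond to the enumeration `m`, we have `φ(b; y) ∈ p * q` if and only if
`φ(x; y) ∈ p_y ⊗ (h_b(q))_x`. Formulas over `C` which define the same set are identified. -/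
def star (ι : C ↪ₑ[L] C') (m : I ≃ M) (p q : Set (ParamFormula L C I)) :
    Set (ParamFormula L C I) :=
  {ψ | ∃ (φ : L.Formula (I ⊕ I)) (b : I → C),
    (∀ v : I → C, ψ.Realize (Sum.elim id v) ↔ (inst φ b).Realize (Sum.elim id v)) ∧
    φ.relabel (Sum.inr : I ⊕ I → M ⊕ (I ⊕ I)) ∈ morley p (h ι m b q)}

end Types

end StarProduct

/-! Everything is reduced to one relation, `IsShadow m q a b`: `θ(a, m)` holds iff `θ(b; y) ∈ q`. By
`tp_eq_h_iff` it says that `a` realizes `h_b(q)`; the big model `C'` is needed only there, to write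
`q` as `tp(σ(m)/C)`. Thus `φ(b; y) ∈ p * q` iff `φ(a; y) ∈ p` for a shadow `a` of `b`.

Shadows of tuples of length at most `|I|` exist by saturation of `C` (`exists_isShadow`). They have
the same type over `∅` as the original tuple, and any two shadows of one tuple have the same type
over `M`, so an invariant `p` does not distinguish them. Hence the product does not depend on how a
formula over `C` is written as `φ(b; y)` (`IsShadow.inst_mem_congr`), and finite parameter tuples
suffice (`mem_star_iff_of_isShadow`).

Associativity is then composition of shadows: if `a` is an `r`-shadow of `b` and `c` a `q`-shadow of
`a`, then `c` is a `q * r`-shadow of `b`, and both products contain `φ(b; y)` iff `φ(c; y) ∈ p`. -/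

namespace StarProduct

/-! ### Finite support of formulas and projections. -/

section Formulas

variable {L : FirstOrder.Language.{u, v}}

/-- Realization of a formula depends only on finitely many of its variables. -/
theorem exists_finset_realize_iff {α : Type x} (φ : L.Formula α) :
    ∃ s : Finset α, ∀ (N : Type w) [L.Structure N] (v₁ v₂ : α → N),
      (∀ a ∈ s, v₁ a = v₂ a) → (φ.Realize v₁ ↔ φ.Realize v₂) := by
  classical
  refine ⟨φ.freeVarFinset, fun N _ v₁ v₂ hv => ?_⟩
  have h₁ := FirstOrder.Language.BoundedFormula.realize_restrictFreeVar (φ := φ) (f := id)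
    (v := fun a => v₁ a) (xs := default) v₁ fun _ => rfl
  have h₂ := FirstOrder.Language.BoundedFormula.realize_restrictFreeVar (φ := φ) (f := id)
    (v := fun a => v₁ a) (xs := default) v₂ fun a => hv a a.2
  exact h₁.symm.trans h₂

/-- Existential quantification over an arbitrary, possibly infinite, set of variables. -/
theorem exists_projection {α : Type x} {β : Type y} (φ : L.Formula (α ⊕ β)) :
    ∃ χ : L.Formula α, ∀ (N : Type w) [L.Structure N] [Nonempty N] (a : α → N),
      χ.Realize a ↔ ∃ b : β → N, φ.Realize (Sum.elim a b) := by
  classical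
  let F := φ.freeVarFinset.toRight
  let f : φ.freeVarFinset → α ⊕ F := fun z =>
    match z with
    | ⟨Sum.inl a, _⟩ => Sum.inl a
    | ⟨Sum.inr b, hb⟩ => Sum.inr ⟨b, by simpa [F] using hb⟩
  refine ⟨FirstOrder.Language.Formula.iExs F (φ.restrictFreeVar f), fun N _ _ a => ?_⟩
  rw [FirstOrder.Language.Formula.realize_iExs]
  constructor
  · rintro ⟨b, hb⟩
    -- Variables outside `F` do not occur in `φ`, so any value will do.
    refine ⟨fun j => if hj : j ∈ F then b ⟨j, hj⟩ else Classical.arbitrary N, ?_⟩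
    refine (FirstOrder.Language.BoundedFormula.realize_restrictFreeVar _ ?_).1 hb
    rintro ⟨i | j, hj⟩
    · rfl
    · have : j ∈ F := by simpa [F] using hj
      simp [f, this]
  · rintro ⟨b, hb⟩
    refine ⟨fun j => b j, ?_⟩
    refine (FirstOrder.Language.BoundedFormula.realize_restrictFreeVar _ ?_).2 hb
    rintro ⟨i | j, hj⟩ <;> rfl

/-- A formula uses only finitely many of its parameter variables. -/
theorem exists_finite_parameters {X : Type x} {Y : Type y} (φ : L.Formula (X ⊕ Y)) :
    ∃ (n : ℕ) (e : Fin n → X) (χ : L.Formula (Fin n ⊕ Y)),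
      ∀ (N : Type w) [L.Structure N] (a : X → N) (c : Y → N),
        χ.Realize (Sum.elim (a ∘ e) c) ↔ φ.Realize (Sum.elim a c) := by
  classical
  let F := φ.freeVarFinset.toLeft
  let f : φ.freeVarFinset → Fin F.card ⊕ Y := fun z =>
    match z with
    | ⟨Sum.inl a, ha⟩ => Sum.inl (F.equivFin ⟨a, by simpa [F] using ha⟩)
    | ⟨Sum.inr b, _⟩ => Sum.inr b
  refine ⟨F.card, fun i => (F.equivFin.symm i : X), φ.restrictFreeVar f, fun N _ a c => ?_⟩
  refine FirstOrder.Language.BoundedFormula.realize_restrictFreeVar _ ?_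
  rintro ⟨i | j, hj⟩ <;> simp [f]

@[simp]
theorem realize_inst {C : Type w} [L.Structure C] {X : Type x} {Y : Type y}
    (φ : L.Formula (X ⊕ Y)) (b : X → C) (v : Y → C) :
    (inst φ b).Realize (Sum.elim id v) ↔ φ.Realize (Sum.elim b v) := by
  rw [inst, FirstOrder.Language.Formula.realize_relabel, Sum.elim_comp_map]
  rfl

end Formulas

/-! ### From one-variable saturation to small infinite tuples. -/

section Saturation

variable {L : FirstOrder.Language.{u, v}} {N : Type w} [L.Structure N] {V : Type x}

/-- The finite parts of `Γ` are satisfiable by assignments extending the finite parts of the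
graph `S` of a partial assignment. -/
def IsFinSatWith (Γ : Set (L.Formula V)) (S : Set (V × N)) : Prop :=
  ∀ (s : Finset (L.Formula V)) (t : Finset (V × N)), (s : Set _) ⊆ Γ → (t : Set _) ⊆ S →
    ∃ v : V → N, (∀ φ ∈ s, φ.Realize v) ∧ ∀ z ∈ t, v z.1 = z.2

theorem IsFinSatWith.functional {Γ : Set (L.Formula V)} {S : Set (V × N)}
    (hS : IsFinSatWith Γ S) {y : V} {c d : N} (hc : (y, c) ∈ S) (hd : (y, d) ∈ S) : c = d := by
  classical
  obtain ⟨v, -, hv⟩ := hS ∅ {(y, c), (y, d)} (by simp) (by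
    intro z hz
    simp only [Finset.coe_insert, Finset.coe_singleton, Set.mem_insert_iff,
      Set.mem_singleton_iff] at hz
    rcases hz with rfl | rfl <;> assumption)
  exact (hv (y, c) (by simp)).symm.trans (hv (y, d) (by simp))

/-- In a saturated structure, a small finitely satisfiable partial assignment can be extended to
one more variable. -/
theorem IsFinSatWith.exists_insert [Nonempty N] {κ : Cardinal.{w}} (hN : IsSaturated L N κ)
    (hV : Cardinal.lift.{w} #V < Cardinal.lift.{x} κ)
    {Γ : Set (L.Formula V)} {S : Set (V × N)} (hS : IsFinSatWith Γ S) (x : V) :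
    ∃ c : N, IsFinSatWith Γ (insert (x, c) S) := by
  classical
  let A : Set N := Prod.snd '' S
  have hA : #A < κ := by
    have hdom : ∀ a : A, ∃ y : V, (y, (a : N)) ∈ S := by
      rintro ⟨_, ⟨y, c⟩, hz, rfl⟩
      exact ⟨y, hz⟩
    choose g hg using hdom
    have hinj : Function.Injective g := fun a b hab =>
      Subtype.ext (hS.functional (hg a) (by rw [hab]; exact hg b))
    exact Cardinal.lift_lt.{w, x}.1 ((Cardinal.lift_mk_le_lift_mk_of_injective hinj).trans_lt hV)
  -- The conditions that finite parts of `Γ` and `S` impose on the value at `x`, specified by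
  -- meaning; `Θ` below supplies actual formulas.
  let Δ : Set (ParamFormula L A Unit) := {χ | ∃ (s : Finset (L.Formula V))
    (t : Finset (V × N)), (s : Set _) ⊆ Γ ∧ (t : Set _) ⊆ S ∧
    ∀ c : N, χ.Realize (Sum.elim (fun a : A => (a : N)) fun _ => c) ↔
      ∃ v : V → N, (∀ φ ∈ s, φ.Realize v) ∧ (∀ z ∈ t, v z.1 = z.2) ∧ v x = c}
  obtain ⟨c, hc⟩ := hN A hA Δ (by
    intro Δ₀ hΔ₀
    have hΔ₀' : ∀ χ : Δ₀, (χ : ParamFormula L A Unit) ∈ Δ := fun χ => hΔ₀ χ.2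
    choose s t hs ht hst using hΔ₀'
    obtain ⟨v, hv, hv'⟩ := hS (Finset.univ.biUnion s) (Finset.univ.biUnion t)
      (by simpa using hs) (by simpa using ht)
    refine ⟨v x, fun χ hχ => (hst ⟨χ, hχ⟩ _).2 ⟨v, fun φ hφ => hv φ ?_, fun z hz => hv' z ?_, rfl⟩⟩
    · exact Finset.mem_biUnion.2 ⟨_, Finset.mem_univ _, hφ⟩
    · exact Finset.mem_biUnion.2 ⟨_, Finset.mem_univ _, hz⟩)
  refine ⟨c, fun s t hs ht => ?_⟩
  -- Sets aside the new pair `(x, c)`, whose second entry need not lie in `A`.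
  let t' := t.filter (· ∈ S)
  have ht' : ∀ z : t', (z : V × N).2 ∈ A := fun z =>
    ⟨z, (Finset.mem_filter.1 z.2).2, rfl⟩
  let Θ : L.Formula ((A ⊕ Unit) ⊕ V) :=
    (FirstOrder.Language.Formula.iInf fun φ : s =>
      (φ : L.Formula V).relabel (Sum.inr : V → (A ⊕ Unit) ⊕ V)) ⊓
    (FirstOrder.Language.Formula.iInf fun z : t' =>
      (FirstOrder.Language.Term.var (Sum.inr (z : V × N).1) : L.Term ((A ⊕ Unit) ⊕ V)).equal
        (FirstOrder.Language.Term.var (Sum.inl (Sum.inl ⟨_, ht' z⟩)))) ⊓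
    (FirstOrder.Language.Term.var (Sum.inr x) : L.Term ((A ⊕ Unit) ⊕ V)).equal
      (FirstOrder.Language.Term.var (Sum.inl (Sum.inr ())))
  obtain ⟨χ, hχ⟩ := exists_projection.{u, v, w, w, x} Θ
  have hχ' : ∀ d : N, χ.Realize (Sum.elim (fun a : A => (a : N)) fun _ => d) ↔
      ∃ v : V → N, (∀ φ ∈ s, φ.Realize v) ∧ (∀ z ∈ t', v z.1 = z.2) ∧ v x = d := by
    intro d
    rw [hχ]
    simp [Θ, FirstOrder.Language.Formula.realize_relabel,
      FirstOrder.Language.Formula.realize_equal, and_assoc, -Prod.forall]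
  obtain ⟨v, hv, hvt, hvx⟩ := (hχ' c).1 (hc χ ⟨s, t', hs, by
    intro z hz; exact (Finset.mem_filter.1 hz).2, hχ'⟩)
  refine ⟨v, hv, fun z hz => ?_⟩
  rcases ht hz with rfl | hzS
  · exact hvx
  · exact hvt z (Finset.mem_filter.2 ⟨hz, hzS⟩)

/-- A saturated structure realizes small finitely satisfiable sets of formulas in
arbitrarily many variables, extending a given partial assignment. -/
theorem IsSaturated.exists_realize [Nonempty N] {κ : Cardinal.{w}} (hN : IsSaturated L N κ)
    (hV : Cardinal.lift.{w} #V < Cardinal.lift.{x} κ)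
    {Γ : Set (L.Formula V)} {S₀ : Set (V × N)} (hS₀ : IsFinSatWith Γ S₀) :
    ∃ v : V → N, (∀ φ ∈ Γ, φ.Realize v) ∧ ∀ z ∈ S₀, v z.1 = z.2 := by
  classical
  obtain ⟨S, hS₀S, hS⟩ := zorn_subset_nonempty {S : Set (V × N) | IsFinSatWith Γ S} (by
    intro c hc hchain hne
    refine ⟨⋃₀ c, fun s t hs ht => ?_, fun s hs => Set.subset_sUnion_of_mem hs⟩
    obtain ⟨S, hSc, htS⟩ := hchain.directedOn.exists_mem_subset_of_finite_of_subset_sUnion hne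
      t.finite_toSet ht
    exact hc hSc s t hs htS) S₀ hS₀
  have htotal : ∀ x : V, ∃ c : N, (x, c) ∈ S := fun x => by
    obtain ⟨c, hc⟩ := IsFinSatWith.exists_insert hN hV hS.prop x
    exact ⟨c, hS.le_of_ge hc (Set.subset_insert _ _) (Set.mem_insert _ _)⟩
  choose v hv using htotal
  refine ⟨v, fun φ hφ => ?_, fun z hz => hS.prop.functional (hv z.1) (hS₀S hz)⟩
  obtain ⟨F, hF⟩ := exists_finset_realize_iff.{u, v, w, x} φ
  obtain ⟨v', hv', hv''⟩ := hS.prop {φ} (F.image fun y => (y, v y)) (by simpa using hφ) (by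
    intro z hz
    obtain ⟨y, -, rfl⟩ := Finset.mem_image.1 hz
    exact hv y)
  exact (hF N v' v fun y hy => hv'' (y, v y) (Finset.mem_image_of_mem _ hy)).1
    (hv' φ (Finset.mem_singleton_self _))

end Saturation

/-! ### Complete types over `C`, and invariance for long tuples. -/

section CompleteTypes

variable {L : FirstOrder.Language.{u, v}} {C : Type w} [L.Structure C] {Y : Type x}
  {p : Set (ParamFormula L C Y)}

theorem IsCompleteType.not_mem_iff (hp : IsCompleteType p) (φ : ParamFormula L C Y) :
    φ.not ∈ p ↔ φ ∉ p := by
  classical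
  refine ⟨fun hn h => ?_, fun h => (hp.complete φ).resolve_left h⟩
  obtain ⟨v, hv⟩ := hp.finitelySatisfiable {φ, φ.not} (by
    intro z hz
    simp only [Finset.coe_insert, Finset.coe_singleton, Set.mem_insert_iff,
      Set.mem_singleton_iff] at hz
    rcases hz with rfl | rfl <;> assumption)
  exact FirstOrder.Language.Formula.realize_not.1 (hv φ.not (by simp)) (hv φ (by simp))

/-- Complete types are closed under consequences of finitely many members. -/
theorem IsCompleteType.mem_of_realize (hp : IsCompleteType p) (s : Finset (ParamFormula L C Y))
    (hs : (s : Set _) ⊆ p) {ψ : ParamFormula L C Y}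
    (h : ∀ v : Y → C, (∀ φ ∈ s, φ.Realize (Sum.elim id v)) → ψ.Realize (Sum.elim id v)) :
    ψ ∈ p := by
  classical
  by_contra hψ
  obtain ⟨v, hv⟩ := hp.finitelySatisfiable (insert ψ.not s) (by
    rw [Finset.coe_insert]
    exact Set.insert_subset ((hp.not_mem_iff ψ).2 hψ) hs)
  exact FirstOrder.Language.Formula.realize_not.1 (hv _ (Finset.mem_insert_self _ _))
    (h v fun φ hφ => hv φ (Finset.mem_insert_of_mem hφ))

theorem IsCompleteType.mem_congr (hp : IsCompleteType p) {φ ψ : ParamFormula L C Y}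
    (h : ∀ v : Y → C, φ.Realize (Sum.elim id v) ↔ ψ.Realize (Sum.elim id v)) :
    φ ∈ p ↔ ψ ∈ p :=
  ⟨fun hφ => hp.mem_of_realize {φ} (by simpa using hφ) fun v hv => (h v).1 (hv φ (by simp)),
    fun hψ => hp.mem_of_realize {ψ} (by simpa using hψ) fun v hv => (h v).2 (hv ψ (by simp))⟩

theorem IsCompleteType.eq_of_subset {q : Set (ParamFormula L C Y)} (hp : IsCompleteType p)
    (hpq : p ⊆ q) (hq : ∀ φ ∈ q, φ.not ∉ q) : p = q :=
  hpq.antisymm fun φ hφ => by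
    by_contra h
    exact hq φ hφ (hpq ((hp.not_mem_iff φ).2 h))

/-- Invariance extends to tuples of arbitrary length. -/
theorem IsInvariant.inst_mem_iff {M : L.ElementarySubstructure C} (hinv : IsInvariant M p)
    (hp : IsCompleteType p) {X : Type y} (φ : L.Formula (X ⊕ Y)) {a b : X → C}
    (hab : tp (L := L) (fun m : M => (m : C)) a = tp (L := L) (fun m : M => (m : C)) b) :
    inst φ a ∈ p ↔ inst φ b ∈ p := by
  obtain ⟨n, e, χ, hχ⟩ := exists_finite_parameters.{u, v, w, y, x} φ
  have hcongr : ∀ c : X → C, inst χ (c ∘ e) ∈ p ↔ inst φ c ∈ p := fun c =>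
    hp.mem_congr fun v => by simpa using hχ C c v
  rw [← hcongr a, ← hcongr b]
  refine hinv n χ _ _ (Set.ext fun θ => ?_)
  have h := Set.ext_iff.1 hab (θ.relabel (Sum.map id e))
  simpa [tp, FirstOrder.Language.Formula.realize_relabel, Sum.elim_comp_map] using h

end CompleteTypes

/-! ### Shadows: realizations of `h_b(q)` described inside `C`. -/

section Shadow

variable {L : FirstOrder.Language.{u, v}} {C : Type w} [L.Structure C]
  {M : L.ElementarySubstructure C} {I : Type x}

/-- The tuple `a` realizes `h_b(q)`: a formula holds of `a` and `m` if and only if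
its instance at `b` belongs to `q`. -/
def IsShadow (m : I ≃ M) (q : Set (ParamFormula L C I)) {X : Type z} (a b : X → C) : Prop :=
  ∀ θ : L.Formula (X ⊕ I), θ.Realize (Sum.elim a (tuple m)) ↔ inst θ b ∈ q

variable {m : I ≃ M} {p q : Set (ParamFormula L C I)}

theorem typesAt.relabel_mem_iff (hq : q ∈ typesAt m) (φ : L.Formula I) :
    φ.relabel (Sum.inr : I → C ⊕ I) ∈ q ↔ φ.Realize (tuple m) := by
  refine ⟨fun h => ?_, hq.2 φ⟩
  by_contra hn
  have h' := hq.2 φ.not (FirstOrder.Language.Formula.realize_not.2 hn)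
  refine (hq.1.not_mem_iff _).1 ((hq.1.mem_congr fun v => ?_).1 h') h
  simp [FirstOrder.Language.Formula.realize_relabel]

theorem IsShadow.comp {X : Type z} {X' : Type y} {a b : X → C} (hq : IsCompleteType q)
    (h : IsShadow m q a b) (e : X' → X) : IsShadow m q (a ∘ e) (b ∘ e) := by
  intro θ
  have hθ := h (θ.relabel (Sum.map e id))
  rw [FirstOrder.Language.Formula.realize_relabel, Sum.elim_comp_map, Function.comp_id] at hθ
  rw [hθ]
  refine hq.mem_congr fun v => ?_
  simp [FirstOrder.Language.Formula.realize_relabel, Sum.elim_comp_map]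

/-- A tuple and its shadow have the same type over the empty set. -/
theorem IsShadow.realize_iff {X : Type z} {a b : X → C} (hq : IsCompleteType q)
    (h : IsShadow m q a b) (χ : L.Formula X) : χ.Realize a ↔ χ.Realize b := by
  have key : ∀ χ : L.Formula X, χ.Realize a → χ.Realize b := fun χ ha => by
    have hmem : inst (χ.relabel (Sum.inl : X → X ⊕ I)) b ∈ q :=
      (h _).1 (by simpa [FirstOrder.Language.Formula.realize_relabel] using ha)
    obtain ⟨w, hw⟩ := hq.finitelySatisfiable {_} (by simpa using hmem)
    have hw' := hw _ (Finset.mem_singleton_self _)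
    rwa [realize_inst, FirstOrder.Language.Formula.realize_relabel, Sum.elim_comp_inl] at hw'
  refine ⟨key χ, fun hb => ?_⟩
  by_contra ha
  exact FirstOrder.Language.Formula.realize_not.1
    (key χ.not (FirstOrder.Language.Formula.realize_not.2 ha)) hb

/-- Two shadows of the same tuple have the same type over `M`. -/
theorem IsShadow.tp_eq {X : Type z} {a a' b : X → C}
    (h : IsShadow m q a b) (h' : IsShadow m q a' b) :
    tp (L := L) (fun c : M => (c : C)) a = tp (L := L) (fun c : M => (c : C)) a' := by
  ext θ
  -- Since `m` enumerates `M`, parameters from `M` become variables `y` evaluated at `m`.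
  have key := (h (θ.relabel (Sum.elim (Sum.inr ∘ m.symm) Sum.inl))).trans
    (h' (θ.relabel (Sum.elim (Sum.inr ∘ m.symm) Sum.inl))).symm
  have hm : tuple m ∘ m.symm = fun c : M => (c : C) := by
    funext c; simp [tuple]
  simpa [tp, FirstOrder.Language.Formula.realize_relabel, Sum.comp_elim,
    ← Function.comp_assoc, hm] using key

/-- Shadows of tuples indexed by `I` exist. -/
theorem exists_isShadow [Infinite C] {κ : Cardinal.{w}} (hC : IsSaturated L C κ) (hM : #M < κ)
    [Infinite I] (hq : q ∈ typesAt m) (b : I → C) : ∃ a : I → C, IsShadow m q a b := by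
  classical
  have hV : Cardinal.lift.{w} #(I ⊕ I) < Cardinal.lift.{x} κ := by
    rw [Cardinal.mk_sum, Cardinal.lift_id, Cardinal.add_eq_self (Cardinal.aleph0_le_mk I),
      Cardinal.mk_congr_lift m]
    exact Cardinal.lift_lt.2 hM
  obtain ⟨v, hv, hv'⟩ := hC.exists_realize (Γ := {θ : L.Formula (I ⊕ I) | inst θ b ∈ q})
    (S₀ := Set.range fun i : I => (Sum.inr i, tuple m i)) hV (by
      intro s t hs ht
      -- The swap makes the projection eliminate `x`: `χ(y)` is `∃ x ⋀ φ(x; y)`. It lies in `q`,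
      -- with `b` as witness, so it holds of `m`.
      let Θ : L.Formula (I ⊕ I) :=
        (FirstOrder.Language.Formula.iInf fun φ : s => (φ : L.Formula (I ⊕ I))).relabel Sum.swap
      obtain ⟨χ, hχ⟩ := exists_projection.{u, v, w, x, x} Θ
      have hχq : χ.relabel (Sum.inr : I → C ⊕ I) ∈ q :=
        hq.1.mem_of_realize (s.image fun φ => inst φ b) (by
          intro ψ hψ
          obtain ⟨φ, hφ, rfl⟩ := Finset.mem_image.1 hψ
          exact hs hφ) fun v hv => by
            rw [FirstOrder.Language.Formula.realize_relabel, Sum.elim_comp_inr, hχ]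
            refine ⟨b, ?_⟩
            simp only [Θ, FirstOrder.Language.Formula.realize_relabel,
              FirstOrder.Language.Formula.realize_iInf, Sum.elim_swap]
            intro φ
            exact (realize_inst _ _ _).1 (hv _ (Finset.mem_image_of_mem _ φ.2))
      obtain ⟨a, ha⟩ := (hχ C _).1 ((typesAt.relabel_mem_iff hq χ).1 hχq)
      simp only [Θ, FirstOrder.Language.Formula.realize_relabel,
        FirstOrder.Language.Formula.realize_iInf, Sum.elim_swap] at ha
      refine ⟨Sum.elim a (tuple m), fun φ hφ => ha ⟨φ, hφ⟩, fun z hz => ?_⟩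
      obtain ⟨i, rfl⟩ := ht hz
      rfl)
  have hva : v = Sum.elim (v ∘ Sum.inl) (tuple m) := by
    funext z
    rcases z with i | i
    · rfl
    · exact hv' (Sum.inr i, tuple m i) ⟨i, rfl⟩
  refine ⟨v ∘ Sum.inl, fun θ => ⟨fun h => ?_, fun h => by rw [← hva]; exact hv θ h⟩⟩
  by_contra hn
  have hnot : inst θ.not b ∈ q :=
    (hq.1.mem_congr fun w => by simp).1 ((hq.1.not_mem_iff (inst θ b)).2 hn)
  have := hv θ.not hnot
  rw [hva] at this
  exact FirstOrder.Language.Formula.realize_not.1 this h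

/-- Shadows of tuples which are not longer than `I` exist. -/
theorem exists_isShadow_of_embedding [Infinite C] {κ : Cardinal.{w}} (hC : IsSaturated L C κ)
    (hM : #M < κ) [Infinite I] (hq : q ∈ typesAt m) {X : Type z} (e : X ↪ I) (b : X → C) :
    ∃ a : X → C, IsShadow m q a b := by
  obtain ⟨a, ha⟩ := exists_isShadow hC hM hq
    (Function.extend e b fun _ => Classical.arbitrary C)
  refine ⟨a ∘ e, ?_⟩
  have := ha.comp hq.1 e
  rwa [Function.extend_comp e.injective] at this

/-- Equivalent formulas over tuples remain equivalent over shadows of these tuples, as far as an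
invariant type is concerned. -/
theorem IsShadow.inst_mem_congr [Infinite C] {κ : Cardinal.{w}} (hC : IsSaturated L C κ)
    (hM : #M < κ) [Infinite I] (hp : p ∈ invTypesAt m) (hq : q ∈ typesAt m)
    {X : Type z} {X' : Type y} (e : X ⊕ X' ↪ I)
    {a b : X → C} {a' b' : X' → C} (h : IsShadow m q a b) (h' : IsShadow m q a' b')
    {φ : L.Formula (X ⊕ I)} {φ' : L.Formula (X' ⊕ I)}
    (hφ : ∀ v : I → C, (inst φ b).Realize (Sum.elim id v) ↔
      (inst φ' b').Realize (Sum.elim id v)) :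
    inst φ a ∈ p ↔ inst φ' a' ∈ p := by
  obtain ⟨d, hd⟩ := exists_isShadow_of_embedding hC hM hq e (Sum.elim b b')
  have hd₁ : IsShadow m q (d ∘ Sum.inl) b := hd.comp hq.1 Sum.inl
  have hd₂ : IsShadow m q (d ∘ Sum.inr) b' := hd.comp hq.1 Sum.inr
  rw [hp.2.inst_mem_iff hp.1.1 φ (h.tp_eq hd₁), hp.2.inst_mem_iff hp.1.1 φ' (h'.tp_eq hd₂)]
  refine hp.1.1.mem_congr fun v => ?_
  -- `Θ` expresses disagreement. That no `y` satisfies it is a formula true of `(b, b')`, hence of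
  -- the joint shadow `d`.
  let Θ : L.Formula ((X ⊕ X') ⊕ I) :=
    ((φ.relabel (Sum.map Sum.inl id)).iff (φ'.relabel (Sum.map Sum.inr id))).not
  have hΘ : ∀ (c : X ⊕ X' → C) (w : I → C), Θ.Realize (Sum.elim c w) ↔
      ¬ (φ.Realize (Sum.elim (c ∘ Sum.inl) w) ↔ φ'.Realize (Sum.elim (c ∘ Sum.inr) w)) := by
    intro c w
    simp [Θ, FirstOrder.Language.Formula.realize_relabel, Sum.elim_comp_map,
      FirstOrder.Language.Formula.realize_iff]
  obtain ⟨χ, hχ⟩ := exists_projection.{u, v, w, max y z, x} Θ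
  have hχd : ¬ χ.Realize d := by
    rw [hd.realize_iff hq.1, hχ]
    rintro ⟨v', hv'⟩
    exact (hΘ _ _).1 hv' (by simpa using hφ v')
  by_contra hne
  exact hχd ((hχ C d).2 ⟨v, (hΘ _ _).2 (by simpa using hne)⟩)

end Shadow

/-! ### Room in `I` for concatenated tuples. -/

section Embeddings

theorem nonempty_embedding_of_finite (X : Type z) (I : Type x) [Finite X] [Infinite I] :
    Nonempty (X ↪ I) := by
  obtain ⟨n, ⟨e⟩⟩ := Finite.exists_equiv_fin X
  exact ⟨e.toEmbedding.trans (Fin.valEmbedding.trans (Infinite.natEmbedding I))⟩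

theorem nonempty_sum_embedding_of_embedding {X : Type z} {I : Type x} [Infinite I] (e : X ↪ I) :
    Nonempty (X ⊕ I ↪ I) := by
  obtain ⟨f⟩ : Nonempty (I ⊕ I ≃ I) := Cardinal.eq.1 (by
    rw [Cardinal.mk_sum, Cardinal.lift_id, Cardinal.add_eq_self (Cardinal.aleph0_le_mk I)])
  exact ⟨(e.sumMap (Function.Embedding.refl I)).trans f.toEmbedding⟩

end Embeddings

/-! ### The product through shadows; closure and associativity. -/

section Star

variable {L : FirstOrder.Language.{u, v}} {C : Type w} [L.Structure C]
  {M : L.ElementarySubstructure C} {I : Type x} {m : I ≃ M}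
  {C' : Type y} [L.Structure C'] {p q r : Set (ParamFormula L C I)}

/-- Every type in `S_m(C)` is of the form `tp(σ(m)/C)` for an automorphism `σ` of `C'`. -/
theorem exists_equiv_eq_tp [Infinite C] {κ' : Cardinal.{y}} (hC' : IsMonster L C' κ')
    (ι : C ↪ₑ[L] C') (hCC' : Cardinal.lift.{y} #C < Cardinal.lift.{w} κ') (hq : q ∈ typesAt m) :
    ∃ σ : C' ≃[L] C', q = tp ι (fun i => σ (ι (tuple m i))) := by
  classical
  have hinj : Function.Injective (tuple m) := Subtype.val_injective.comp m.injective
  have hIC : Cardinal.lift.{w} #I ≤ Cardinal.lift.{x} #C :=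
    Cardinal.lift_mk_le_lift_mk_of_injective hinj
  have hV : Cardinal.lift.{y} #(C ⊕ I) < Cardinal.lift.{max w x} κ' := by
    have h₁ : #(C ⊕ I) = Cardinal.lift.{x} #C := by
      rw [Cardinal.mk_sum]
      exact Cardinal.add_eq_left (by simp) hIC
    rw [h₁]
    have h₂ := Cardinal.lift_lt.{max w y, x}.2 hCC'
    simpa only [Cardinal.lift_lift, Cardinal.lift_umax] using h₂
  have : Nonempty C' := ⟨ι (Classical.arbitrary C)⟩
  obtain ⟨v, hv, hv'⟩ := hC'.saturated.exists_realize (Γ := q)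
    (S₀ := Set.range fun c : C => (Sum.inl c, ι c)) hV (by
      intro s t hs ht
      obtain ⟨w, hw⟩ := hq.1.finitelySatisfiable s hs
      refine ⟨ι ∘ Sum.elim id w, fun φ hφ => (ι.map_formula φ _).2 (hw φ hφ), fun z hz => ?_⟩
      obtain ⟨c, rfl⟩ := ht hz
      rfl)
  have hva : v = Sum.elim ι (v ∘ Sum.inr) := by
    funext z
    rcases z with c | i
    · exact hv' (Sum.inl c, ι c) ⟨c, rfl⟩
    · rfl
  have hqtp : q = tp ι (v ∘ Sum.inr) := hq.1.eq_of_subset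
    (fun φ hφ => by
      change φ.Realize _
      rw [← hva]
      exact hv φ hφ)
    fun φ hφ hn => FirstOrder.Language.Formula.realize_not.1 hn hφ
  have hιm : Function.Injective (ι ∘ tuple m) := ι.injective.comp hinj
  let E : I ≃ Set.range (ι ∘ tuple m) := Equiv.ofInjective _ hιm
  have hA : #(Set.range (ι ∘ tuple m)) < κ' := by
    have h₁ : Cardinal.lift.{w} #(Set.range (ι ∘ tuple m)) ≤ Cardinal.lift.{y} #C := by
      have h₂ : Set.range (ι ∘ tuple m) ⊆ Set.range ι := Set.range_comp_subset_range _ _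
      exact (Cardinal.lift_le.2 (Cardinal.mk_le_mk_of_subset h₂)).trans Cardinal.mk_range_le_lift
    exact Cardinal.lift_lt.1 (h₁.trans_lt hCC')
  -- The map from `m` to the realization of `q` is elementary because `q` contains `tp(m/∅)`.
  obtain ⟨σ, hσ⟩ := hC'.homogeneous _ hA (fun a => v (Sum.inr (E.symm a))) (by
    intro φ
    have h₁ := typesAt.relabel_mem_iff hq (φ.relabel E.symm)
    rw [← ι.map_formula, hqtp] at h₁
    simp only [tp, Set.mem_ofPred_eq, FirstOrder.Language.Formula.realize_relabel,
      Sum.elim_comp_inr] at h₁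
    have h₂ : (ι ∘ tuple m) ∘ E.symm = fun a : Set.range (ι ∘ tuple m) => (a : C') := by
      funext a
      exact congrArg Subtype.val (E.apply_symm_apply a)
    rw [h₂] at h₁
    exact h₁.symm)
  refine ⟨σ, hqtp.trans (congrArg _ (funext fun i => ?_))⟩
  have h₁ := hσ (E i)
  rw [E.symm_apply_apply] at h₁
  exact h₁.symm

/-- The realizations of `h_b(q)` are the shadows of `b`. -/
theorem tp_eq_h_iff [Infinite C] {κ' : Cardinal.{y}} (hC' : IsMonster L C' κ')
    (ι : C ↪ₑ[L] C') (hCC' : Cardinal.lift.{y} #C < Cardinal.lift.{w} κ') (hq : q ∈ typesAt m)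
    {X : Type z} (a b : X → C) :
    tp (L := L) (fun c : M => (c : C)) a = h ι m b q ↔ IsShadow m q a b := by
  let k : M ⊕ X → X ⊕ I := Sum.elim (Sum.inr ∘ m.symm) Sum.inl
  have hσ : ∀ (σ : C' ≃[L] C') (θ : ParamFormula L M X),
      θ ∈ tp (L := L) (fun a : M => ι (a : C)) (fun j => σ.symm (ι (b j))) ↔
        inst (θ.relabel k) b ∈ tp (L := L) ι (fun i => σ (ι (tuple m i))) := by
    intro σ θ
    simp only [tp, inst, Set.mem_ofPred_eq, FirstOrder.Language.Formula.realize_relabel]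
    rw [← FirstOrder.Language.StrongHomClass.realize_formula σ]
    apply iff_of_eq
    congr 1
    funext z
    rcases z with c | j <;> simp [k, tuple]
  have hh : ∀ θ : ParamFormula L M X, θ ∈ h ι m b q ↔ inst (θ.relabel k) b ∈ q := by
    intro θ
    constructor
    · rintro ⟨σ, rfl, hθ⟩
      exact (hσ σ θ).1 hθ
    · intro hθ
      obtain ⟨σ, hσq⟩ := exists_equiv_eq_tp hC' ι hCC' hq
      exact ⟨σ, hσq, (hσ σ θ).2 (hσq ▸ hθ)⟩
  have htp : ∀ θ : ParamFormula L M X, θ ∈ tp (L := L) (fun c : M => (c : C)) a ↔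
      (θ.relabel k).Realize (Sum.elim a (tuple m)) := by
    intro θ
    simp only [tp, Set.mem_ofPred_eq, FirstOrder.Language.Formula.realize_relabel]
    apply iff_of_eq
    congr 1
    funext z
    rcases z with c | j <;> simp [k, tuple]
  constructor
  · intro heq θ
    -- `k'` turns the variables `y` back into parameters from `M`, so every `θ` arises from an
    -- `L(M)`-formula.
    let k' : X ⊕ I → M ⊕ X := Sum.elim Sum.inr (Sum.inl ∘ m)
    have hk : k ∘ k' = id := by
      funext z
      rcases z with j | i <;> simp [k, k']
    have hreal : ∀ w : X ⊕ I → C, ((θ.relabel k').relabel k).Realize w ↔ θ.Realize w := by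
      intro w
      rw [FirstOrder.Language.Formula.realize_relabel, FirstOrder.Language.Formula.realize_relabel,
        Function.comp_assoc, hk, Function.comp_id]
    rw [← hreal, ← htp, heq, hh]
    exact hq.1.mem_congr fun v => by rw [realize_inst, realize_inst, hreal]
  · intro hs
    ext θ
    rw [htp, hh]
    exact hs _

/-- Formulas in `p * q`, in terms of shadows of tuples indexed by `I`. -/
theorem mem_star_iff [Infinite C] {κ' : Cardinal.{y}} (hC' : IsMonster L C' κ')
    (ι : C ↪ₑ[L] C') (hCC' : Cardinal.lift.{y} #C < Cardinal.lift.{w} κ')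
    (hp : IsCompleteType p) (hq : q ∈ typesAt m) (ψ : ParamFormula L C I) :
    ψ ∈ star ι m p q ↔ ∃ (φ : L.Formula (I ⊕ I)) (a b : I → C),
      (∀ v : I → C, ψ.Realize (Sum.elim id v) ↔ (inst φ b).Realize (Sum.elim id v)) ∧
      IsShadow m q a b ∧ inst φ a ∈ p := by
  have hmor : ∀ (φ : L.Formula (I ⊕ I)) (a : I → C),
      ((φ.relabel (Sum.inr : I ⊕ I → M ⊕ (I ⊕ I))).relabel
        (Sum.elim (fun c : M => Sum.inl (c : C)) (Sum.map a id)) ∈ p) ↔ inst φ a ∈ p := by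
    intro φ a
    refine hp.mem_congr fun v => ?_
    simp only [inst, FirstOrder.Language.Formula.realize_relabel, Function.comp_assoc,
      Sum.elim_comp_inr]
  constructor
  · rintro ⟨φ, b, hψ, a, ha, hφ⟩
    exact ⟨φ, a, b, hψ, (tp_eq_h_iff hC' ι hCC' hq a b).1 ha, (hmor φ a).1 hφ⟩
  · rintro ⟨φ, a, b, hψ, ha, hφ⟩
    exact ⟨φ, b, hψ, a, (tp_eq_h_iff hC' ι hCC' hq a b).2 ha, (hmor φ a).2 hφ⟩

/-- If `a` is a shadow of `b` with respect to `q`, then `φ(b; y) ∈ p * q` if and only if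
`φ(a; y) ∈ p`. -/
theorem mem_star_iff_of_isShadow [Infinite C] {κ : Cardinal.{w}} (hC : IsSaturated L C κ)
    (hM : #M < κ) [Infinite I] {κ' : Cardinal.{y}} (hC' : IsMonster L C' κ')
    (ι : C ↪ₑ[L] C') (hCC' : Cardinal.lift.{y} #C < Cardinal.lift.{w} κ')
    (hp : p ∈ invTypesAt m) (hq : q ∈ typesAt m) {X : Type z} [Finite X] {a b : X → C}
    (hab : IsShadow m q a b) {φ : L.Formula (X ⊕ I)} {ψ : ParamFormula L C I}
    (hψ : ∀ v : I → C, ψ.Realize (Sum.elim id v) ↔ φ.Realize (Sum.elim b v)) :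
    ψ ∈ star ι m p q ↔ inst φ a ∈ p := by
  obtain ⟨e⟩ := nonempty_embedding_of_finite X I
  obtain ⟨e'⟩ := nonempty_sum_embedding_of_embedding e
  rw [mem_star_iff hC' ι hCC' hp.1.1 hq]
  constructor
  · rintro ⟨φ', a', b', hψ', hab', hφ'⟩
    exact (hab.inst_mem_congr hC hM hp hq e' hab' fun v => by
      rw [← hψ' v, hψ v, realize_inst]).2 hφ'
  · intro hφ
    let b' : I → C := Function.extend e b fun _ => Classical.arbitrary C
    have hb' : b' ∘ e = b := Function.extend_comp e.injective b _
    obtain ⟨a', hab'⟩ := exists_isShadow hC hM hq b'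
    have hreal : ∀ v : I → C, ψ.Realize (Sum.elim id v) ↔
        (inst (φ.relabel (Sum.map e id)) b').Realize (Sum.elim id v) := fun v => by
      rw [hψ v, realize_inst, FirstOrder.Language.Formula.realize_relabel, Sum.elim_comp_map, hb',
        Function.comp_id]
    exact ⟨φ.relabel (Sum.map e id), a', b', hreal, hab',
      (hab.inst_mem_congr hC hM hp hq e' hab' fun v => by
        rw [← hreal v, hψ v, realize_inst]).1 hφ⟩

theorem exists_isShadow_of_finite [Infinite C] {κ : Cardinal.{w}} (hC : IsSaturated L C κ)
    (hM : #M < κ) [Infinite I] (hq : q ∈ typesAt m) {X : Type z} [Finite X] (b : X → C) :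
    ∃ a : X → C, IsShadow m q a b := by
  obtain ⟨e⟩ := nonempty_embedding_of_finite X I
  exact exists_isShadow_of_embedding hC hM hq e b

/-- Consistency passes from a shadow to the original tuple, both having the same type over `∅`.
Invariance comes from that of `q`: tuples with the same type over `M` have the same shadows. -/
theorem star_mem_invTypesAt [Infinite C] {κ : Cardinal.{w}} (hC : IsSaturated L C κ)
    (hM : #M < κ) [Infinite I] {κ' : Cardinal.{y}} (hC' : IsMonster L C' κ')
    (ι : C ↪ₑ[L] C') (hCC' : Cardinal.lift.{y} #C < Cardinal.lift.{w} κ')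
    (hp : p ∈ invTypesAt m) (hq : q ∈ invTypesAt m) : star ι m p q ∈ invTypesAt m := by
  classical
  refine ⟨⟨⟨fun s hs => ?_, fun ψ => ?_⟩, fun φ hφ => ?_⟩, fun n φ b b' hbb' => ?_⟩
  · choose n b χ hχ using fun ψ : s =>
      exists_finite_parameters.{u, v, w, w, x} (ψ : ParamFormula L C I)
    -- All parameters of `s` are concatenated so that a single shadow serves every formula.
    let B : (Σ ψ : s, Fin (n ψ)) → C := fun z => b z.1 z.2
    obtain ⟨A, hA⟩ := exists_isShadow_of_finite hC hM hq.1 B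
    let χ' : s → L.Formula ((Σ ψ : s, Fin (n ψ)) ⊕ I) := fun ψ =>
      (χ ψ).relabel (Sum.map (Sigma.mk ψ) id)
    have hχB : ∀ (ψ : s) (v : I → C), (ψ : ParamFormula L C I).Realize (Sum.elim id v) ↔
        (χ' ψ).Realize (Sum.elim B v) := by
      intro ψ v
      rw [FirstOrder.Language.Formula.realize_relabel, Sum.elim_comp_map, Function.comp_id]
      exact (hχ ψ C id v).symm
    have hmem : ∀ ψ : s, inst (χ' ψ) A ∈ p := fun ψ =>
      (mem_star_iff_of_isShadow hC hM hC' ι hCC' hp hq.1 hA (hχB ψ)).1 (hs ψ.2)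
    obtain ⟨v, hv⟩ := hp.1.1.finitelySatisfiable (Finset.univ.image fun ψ => inst (χ' ψ) A)
      (by simpa [Set.range_subset_iff] using hmem)
    obtain ⟨ξ, hξ⟩ := exists_projection.{u, v, w, max u v w x, x}
      (FirstOrder.Language.Formula.iInf χ')
    have hξA : ξ.Realize A := (hξ C A).2 ⟨v, FirstOrder.Language.Formula.realize_iInf.2 fun ψ =>
      (realize_inst _ _ _).1 (hv _ (Finset.mem_image_of_mem _ (Finset.mem_univ ψ)))⟩
    obtain ⟨v', hv'⟩ := (hξ C B).1 ((hA.realize_iff hq.1.1 ξ).1 hξA)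
    exact ⟨v', fun ψ hψ => (hχB ⟨ψ, hψ⟩ v').2
      (FirstOrder.Language.Formula.realize_iInf.1 hv' ⟨ψ, hψ⟩)⟩
  · obtain ⟨n, b, χ, hχ⟩ := exists_finite_parameters.{u, v, w, w, x} ψ
    obtain ⟨a, ha⟩ := exists_isShadow_of_finite hC hM hq.1 b
    rw [mem_star_iff_of_isShadow hC hM hC' ι hCC' hp hq.1 ha (φ := χ)
      fun v => (hχ C id v).symm,
      mem_star_iff_of_isShadow hC hM hC' ι hCC' hp hq.1 ha (φ := χ.not) fun v => by
        rw [FirstOrder.Language.Formula.realize_not, FirstOrder.Language.Formula.realize_not]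
        exact not_congr (hχ C id v).symm]
    refine (hp.1.1.complete (inst χ a)).imp_right fun h => (hp.1.1.mem_congr fun v => ?_).1 h
    simp
  · obtain ⟨a, ha⟩ := exists_isShadow_of_finite hC hM hq.1 (Fin.elim0 : Fin 0 → C)
    -- A formula without parameters is an instance at the empty tuple.
    rw [mem_star_iff_of_isShadow hC hM hC' ι hCC' hp hq.1 ha (φ := φ.relabel Sum.inr) fun v => by
      simp [FirstOrder.Language.Formula.realize_relabel] ]
    refine (hp.1.1.mem_congr fun v => ?_).1 (hp.1.2 φ hφ)
    simp [FirstOrder.Language.Formula.realize_relabel]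
  · obtain ⟨a, ha⟩ := exists_isShadow_of_finite hC hM hq.1 b
    have ha' : IsShadow m q a b' := fun θ => (ha θ).trans (hq.2 n θ b b' hbb')
    rw [mem_star_iff_of_isShadow hC hM hC' ι hCC' hp hq.1 ha (φ := φ) fun v => realize_inst _ _ _,
      mem_star_iff_of_isShadow hC hM hC' ι hCC' hp hq.1 ha' (φ := φ) fun v => realize_inst _ _ _]

theorem star_assoc [Infinite C] {κ : Cardinal.{w}} (hC : IsSaturated L C κ)
    (hM : #M < κ) [Infinite I] {κ' : Cardinal.{y}} (hC' : IsMonster L C' κ')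
    (ι : C ↪ₑ[L] C') (hCC' : Cardinal.lift.{y} #C < Cardinal.lift.{w} κ')
    (hp : p ∈ invTypesAt m) (hq : q ∈ invTypesAt m) (hr : r ∈ invTypesAt m) :
    star ι m (star ι m p q) r = star ι m p (star ι m q r) := by
  have hpq := star_mem_invTypesAt hC hM hC' ι hCC' hp hq
  have hqr := star_mem_invTypesAt hC hM hC' ι hCC' hq hr
  ext ψ
  obtain ⟨n, b, χ, hχ⟩ := exists_finite_parameters.{u, v, w, w, x} ψ
  have hψ : ∀ v : I → C, ψ.Realize (Sum.elim id v) ↔ χ.Realize (Sum.elim b v) :=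
    fun v => (hχ C id v).symm
  obtain ⟨a, ha⟩ := exists_isShadow_of_finite hC hM hr.1 b
  obtain ⟨c, hc⟩ := exists_isShadow_of_finite hC hM hq.1 a
  -- `θ(c, m)` iff `θ(a; y) ∈ q` iff `θ(b; y) ∈ q * r`.
  have hcb : IsShadow m (star ι m q r) c b := fun θ => by
    rw [hc θ, mem_star_iff_of_isShadow hC hM hC' ι hCC' hq hr.1 ha (φ := θ)
      fun v => realize_inst _ _ _]
  rw [mem_star_iff_of_isShadow hC hM hC' ι hCC' hpq hr.1 ha hψ,
    mem_star_iff_of_isShadow hC hM hC' ι hCC' hp hqr.1 hcb hψ,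
    mem_star_iff_of_isShadow hC hM hC' ι hCC' hp hq.1 hc (φ := χ) fun v => realize_inst _ _ _]

end Star

/-- An elementary substructure of an infinite structure is infinite. -/
theorem infinite_of_elementarySubstructure {L : FirstOrder.Language.{u, v}} {C : Type w}
    [L.Structure C] [Infinite C] (M : L.ElementarySubstructure C) : Infinite M :=
  (M.elementarilyEquivalent.infinite_iff).2 inferInstance

end StarProduct

theorem mainTheorem10 {L : FirstOrder.Language.{u, v}}
    {C : Type w} [L.Structure C] [Infinite C] {κ : Cardinal.{w}}
    (hC : StarProduct.IsMonster L C κ)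
    (M : L.ElementarySubstructure C) (hM : Cardinal.mk M < κ)
    {I : Type x} (m : I ≃ M)
    {C' : Type y} [L.Structure C'] {κ' : Cardinal.{y}}
    (hC' : StarProduct.IsMonster L C' κ')
    (ι : C ↪ₑ[L] C')
    (hCC' : Cardinal.lift.{y} (Cardinal.mk C) < Cardinal.lift.{w} κ') :
    (∀ p ∈ StarProduct.invTypesAt m, ∀ q ∈ StarProduct.invTypesAt m,
      StarProduct.star ι m p q ∈ StarProduct.invTypesAt m) ∧
    (∀ p ∈ StarProduct.invTypesAt m, ∀ q ∈ StarProduct.invTypesAt m,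
      ∀ r ∈ StarProduct.invTypesAt m,
      StarProduct.star ι m (StarProduct.star ι m p q) r =
        StarProduct.star ι m p (StarProduct.star ι m q r)) := by
  have : Infinite M := StarProduct.infinite_of_elementarySubstructure M
  have : Infinite I := m.infinite_iff.2 inferInstance
  exact ⟨fun p hp q hq => StarProduct.star_mem_invTypesAt hC.saturated hM hC' ι hCC' hp hq,
    fun p hp q hq r hr => StarProduct.star_assoc hC.saturated hM hC' ι hCC' hp hq hr⟩
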